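/- Let $\mu\ge 3$ be an integer, $\varpi=2\cos(\pi/\mu)$, $q=e^{2\pi i z/\varpi}$ and $\theta=q\,\frac{d}{dq}=\frac{\varpi}{2\pi i}\frac{d}{dz}$ for $z\in\mathbb H$. Let $\mathfrak H(\varpi)$ be the Hecke triangle group of signature $(2,\mu,\infty)$, generated by $z\mapsto -1/z$ and $z\mapsto z+\varpi$, and let $\mathcal M_k$ be its space of automorphic forms of weight $k$ (holomorphic on $\mathbb H$ and at the cusps). Put $a=\frac{\mu+2}{4\mu}$, $b=\frac{\mu-2}{4\mu}$, $c=\frac{3\mu-2}{4\mu}$, and let $y_1,y_2,y_3$ be meromorphic functions on $\mathbb H$ that solve the Darboux–Halphen system $$\begin{aligned}\theta y_1&=(a-1)(y_1y_2+y_1y_3-y_2y_3)+(b+c-1)y_1^2,\\ \theta y_2&=(b-1)(y_2y_1+y_2y_3-y_1y_3)+(a+c-1)y_2^2,\\ \theta y_3&=(c-1)(y_3y_1+y_3y_2-y_1y_2)+(a+b-1)y_3^2,\end{aligned}$$ normalized so that $J=\frac{y_3-y_2}{y_3-y_1}$ is the hauptmodul of $\mathfrak H(\varpi)$, i.e. $J$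 is $\mathfrak H(\varpi)$-invariant with $J(i)=1$, $J(-e^{-\pi i/\mu})=0$, $J(i\infty)=\infty$. Let $$E_2=\tfrac1b\bigl((b-a)y_1-b\,y_2+(a+b-1)y_3\bigr)$$ (the quasiautomorphic form of weight $2$ with $E_2(i\infty)=1$), $\delta=2\,\mathrm{lcm}(2,\mu)$, and $$\Delta=\Bigl(\tfrac{\theta J}{J(J-1)}\Bigr)^{\mu}J\,(J-1)^{\mu/2}\ (\mu\text{ even}),\qquad \Delta=\Bigl(\tfrac{\theta J}{J(J-1)}\Bigr)^{2\mu}J^2(J-1)^{\mu}\ (\mu\text{ odd}),$$ removable singularities being removed. Define $\partial_k f=\theta f-\frac{k(\mu-2)}{4\mu}E_2f$, $\partial_k^0f=f$, $\partial_k^{n+1}f=\partial_{k+2n}(\partial_k^nf)$. Let $w\in\mathbb Z$, $r\ge 0$, $B_{2j}\in\mathcal M_{2j}$ for $2\le j\le r+1$, and consider the equation of order $r+1$ $$\mathsf H_{\mathbf B}[y]:\qquad \partial_{w-r}^{r+1}y+B_4\,\partial_{w-r}^{r-1}y+\cdots+B_{2r+2}\,y=0 .$$ Suppose that the roots, with multiplicity,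 of its indicial polynomial at $q=0$ are integers $\lambda_0\ge\lambda_1\ge\cdots\ge\lambda_r\ge 0$. Let $Y_0,\dots,Y_r$ be a fundamental system of solutions of $\mathsf H_{\mathbf B}[y]$, holomorphic on $\mathbb H$, and let $\mathcal W=\det\bigl(\partial_{w-r}^{j}Y_i\bigr)_{0\le i,j\le r}$ be its Wronskian. Then $$\mathcal W=C\,\Delta^{\frac{w(r+1)}{\delta}}\quad\text{on }\mathbb H$$ for some complex constant $C\ne 0$. Here $\Delta$ has a holomorphic logarithm on $\mathbb H$, and, should the exponent not be an integer, the power is formed with any such logarithm (changing it only changes $C$). -/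

import Mathlib

open UpperHalfPlane hiding I
open Complex
open scoped MatrixGroups Manifold

noncomputable section

namespace Hecke

/-- The width `ϖ_μ = 2 cos (π / μ)`. -/
def width (μ : ℕ) : ℝ := 2 * Real.cos (Real.pi / μ)

/-- The matrix of `z ↦ -1 / z`. -/
def matS : SL(2, ℝ) := ⟨!![0, -1; 1, 0], by simp [Matrix.det_fin_two]⟩

/-- The matrix of `z ↦ z + ϖ_μ`. -/
def matT (μ : ℕ) : SL(2, ℝ) := ⟨!![1, width μ; 0, 1], by simp [Matrix.det_fin_two]⟩

/-- The Hecke triangle group of signature `(2, μ, ∞)`, generated by `z ↦ -1 / z` and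
`z ↦ z + ϖ_μ`. -/
def group (μ : ℕ) : Subgroup (GL (Fin 2) ℝ) :=
  (Subgroup.closure {matS, matT μ}).map Matrix.SpecialLinearGroup.toGL

/-- The space of Hecke automorphic forms of weight `k`: holomorphic on `ℍ`, invariant under the
weight `k` slash action of the Hecke group, bounded at the cusps. -/
abbrev AutomorphicForm (μ : ℕ) (k : ℤ) : Type := ModularForm (group μ) k

/-- The Boole operator `θ = q d/dq = (ϖ / 2πi) d/dz`, where `q = exp (2πi z / ϖ)`. -/
def theta (μ : ℕ) (f : ℂ → ℂ) (z : ℂ) : ℂ := (width μ : ℂ) / (2 * Real.pi * I) * deriv f z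

/-- The Boole operator on functions on the upper half plane. -/
def thetaH (μ : ℕ) (f : ℍ → ℂ) (z : ℍ) : ℂ := theta μ (f ∘ ofComplex) z

/-! ### The Darboux-Halphen system of signature `(2, μ, ∞)` -/

def constA (μ : ℕ) : ℂ := (1 - 1 / 2 + 1 / μ) / 2

def constB (μ : ℕ) : ℂ := (1 - 1 / 2 - 1 / μ) / 2

def constC (μ : ℕ) : ℂ := (1 + 1 / 2 - 1 / μ) / 2

/-- `y₁, y₂, y₃` are meromorphic on the upper half plane and solve the Darboux-Halphen system
there (as an identity of meromorphic functions, that is, off a discrete closed set). -/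
structure IsDarbouxHalphen (μ : ℕ) (y₁ y₂ y₃ : ℂ → ℂ) : Prop where
  mero₁ : MeromorphicOn y₁ upperHalfPlaneSet
  mero₂ : MeromorphicOn y₂ upperHalfPlaneSet
  mero₃ : MeromorphicOn y₃ upperHalfPlaneSet
  eqn₁ : ∀ᶠ z in Filter.codiscreteWithin upperHalfPlaneSet,
    theta μ y₁ z = (constA μ - 1) * (y₁ z * y₂ z + y₁ z * y₃ z - y₂ z * y₃ z)
      + (constB μ + constC μ - 1) * y₁ z ^ 2
  eqn₂ : ∀ᶠ z in Filter.codiscreteWithin upperHalfPlaneSet,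
    theta μ y₂ z = (constB μ - 1) * (y₂ z * y₁ z + y₂ z * y₃ z - y₁ z * y₃ z)
      + (constA μ + constC μ - 1) * y₂ z ^ 2
  eqn₃ : ∀ᶠ z in Filter.codiscreteWithin upperHalfPlaneSet,
    theta μ y₃ z = (constC μ - 1) * (y₃ z * y₁ z + y₃ z * y₂ z - y₁ z * y₂ z)
      + (constA μ + constB μ - 1) * y₃ z ^ 2

/-- `J = (y₃ - y₂) / (y₃ - y₁)`, as a meromorphic function on the upper half plane: the normal
form takes at a removable singularity the value of the continuous extension. -/
def hauptmodul (y₁ y₂ y₃ : ℂ → ℂ) : ℂ → ℂ :=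
  toMeromorphicNFOn (fun z => (y₃ z - y₂ z) / (y₃ z - y₁ z)) upperHalfPlaneSet

/-- The Darboux-Halphen functions of the Hecke group. The Darboux-Halphen system determines its
solution only up to Möbius substitutions in `z`; the solution meant is the one whose quotient `J`
is the hauptmodul of the Hecke group with `J (i) = 1`, `J (-exp (-πi / μ)) = 0`, `J (i∞) = ∞`. -/
structure IsHeckeHalphen (μ : ℕ) (y₁ y₂ y₃ : ℂ → ℂ) : Prop
    extends IsDarbouxHalphen μ y₁ y₂ y₃ where
  automorphic : ∀ γ ∈ group μ, ∀ z : ℍ,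
    hauptmodul y₁ y₂ y₃ ((γ • z : ℍ) : ℂ) = hauptmodul y₁ y₂ y₃ (z : ℂ)
  at_r₁ : hauptmodul y₁ y₂ y₃ I = 1
  at_r₂ : hauptmodul y₁ y₂ y₃ (-exp (-(Real.pi * I) / μ)) = 0
  at_infty : Filter.Tendsto (fun z : ℍ => ‖hauptmodul y₁ y₂ y₃ (z : ℂ)‖) atImInfty Filter.atTop

/-- The quasiautomorphic form `E₂` of weight `2`, normalized by `E₂ (i∞) = 1`. -/
def E2 (μ : ℕ) (y₁ y₂ y₃ : ℂ → ℂ) (z : ℍ) : ℂ :=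
  toMeromorphicNFOn
    (fun x => 1 / constB μ * ((constB μ - constA μ) * y₁ x - constB μ * y₂ x
      + (constB μ + constA μ - 1) * y₃ x))
    upperHalfPlaneSet z

/-- The discriminant built from the hauptmodul `J`, singularities being removed. -/
def discriminant (μ : ℕ) (J : ℂ → ℂ) (z : ℍ) : ℂ :=
  toMeromorphicNFOn
    (fun x =>
      if Even μ then (theta μ J x / (J x * (J x - 1))) ^ μ * J x * (J x - 1) ^ (μ / 2)
      else (theta μ J x / (J x * (J x - 1))) ^ (2 * μ) * J x ^ 2 * (J x - 1) ^ μ)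
    upperHalfPlaneSet z

/-- The weight `δ = 2 lcm (2, μ)` of the discriminant. -/
def delta (μ : ℕ) : ℕ := 2 * Nat.lcm 2 μ

/-! ### Ramanujan-Serre derivatives, the differential equation and the Wronskian

In this part `E` stands for the function `E₂` of the Hecke group. -/

/-- `∂_k f = θ f - (k (μ - 2) / (4 μ)) E₂ f`. -/
def serre (μ : ℕ) (E : ℍ → ℂ) (k : ℤ) (f : ℍ → ℂ) (z : ℍ) : ℂ :=
  thetaH μ f z - (k : ℂ) * ((μ : ℂ) - 2) / (4 * μ) * E z * f z

/-- `∂_k^0 f = f` and `∂_k^(n+1) f = ∂_(k+2n) (∂_k^n f)`. -/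
def serreIter (μ : ℕ) (E : ℍ → ℂ) (k : ℤ) : ℕ → (ℍ → ℂ) → ℍ → ℂ
  | 0, f => f
  | n + 1, f => serre μ E (k + 2 * n) (serreIter μ E k n f)

/-- The left-hand side of the equation
`∂_(w-r)^(r+1) y + B₄ ∂_(w-r)^(r-1) y + ⋯ + B_(2r+2) y = 0`; here `B j` has weight `2 j`, and only
the `B j` with `2 ≤ j ≤ r + 1` occur. -/
def odeLHS (μ : ℕ) (E : ℍ → ℂ) (w : ℤ) (r : ℕ) (B : ∀ j : ℕ, AutomorphicForm μ (2 * j))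
    (y : ℍ → ℂ) (z : ℍ) : ℂ :=
  serreIter μ E (w - r) (r + 1) y z
    + ∑ j ∈ Finset.Icc 2 (r + 1), B j z * serreIter μ E (w - r) (r + 1 - j) y z

/-- The indicial polynomial at `q = 0` of `∂_k^n`: each `θ` becomes `X`, each coefficient its value
at `i∞`. -/
def indicialSerre (μ : ℕ) (E : ℍ → ℂ) (k : ℤ) (n : ℕ) : Polynomial ℂ :=
  ∏ m ∈ Finset.range n,
    (Polynomial.X - Polynomial.C
      (((k + 2 * m : ℤ) : ℂ) * ((μ : ℂ) - 2) / (4 * μ) * valueAtInfty E))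

/-- The indicial polynomial at `q = 0` of the differential equation. -/
def indicial (μ : ℕ) (E : ℍ → ℂ) (w : ℤ) (r : ℕ) (B : ∀ j : ℕ, AutomorphicForm μ (2 * j)) :
    Polynomial ℂ :=
  indicialSerre μ E (w - r) (r + 1)
    + ∑ j ∈ Finset.Icc 2 (r + 1),
        Polynomial.C (valueAtInfty (B j)) * indicialSerre μ E (w - r) (r + 1 - j)

/-- `Y 0, …, Y r` is a fundamental system of solutions, holomorphic on the upper half plane, of
the differential equation, which has order `r + 1`. -/
structure IsFundamentalSolution (μ : ℕ) (E : ℍ → ℂ) (w : ℤ) (r : ℕ)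
    (B : ∀ j : ℕ, AutomorphicForm μ (2 * j)) (Y : Fin (r + 1) → ℍ → ℂ) : Prop where
  holo : ∀ i, MDiff (Y i)
  solves : ∀ i z, odeLHS μ E w r B (Y i) z = 0
  indep : LinearIndependent ℂ Y

/-- The Wronskian `det (∂_(w-r)^j Y_i)`. -/
def wronskian (μ : ℕ) (E : ℍ → ℂ) (w : ℤ) (r : ℕ) (Y : Fin (r + 1) → ℍ → ℂ) (z : ℍ) : ℂ :=
  (Matrix.of fun i j : Fin (r + 1) => serreIter μ E (w - r) j (Y i) z).det

/-- `L` is a holomorphic branch of `log f` on the upper half plane. The powers `f ^ p` with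
`p` rational are then the functions `exp (p L)`. -/
def IsLogBranch (L f : ℍ → ℂ) : Prop := MDiff L ∧ ∀ z, exp (L z) = f z

end Hecke

end

noncomputable section

namespace Hecke

open Filter Topology

/-! ### Logarithmic derivatives of meromorphic functions -/

/-! Both sides satisfy the same first-order linear equation. Rewriting `H_B[y]` as a first-order
system in the Serre derivatives gives a matrix of trace `w(r+1) b E₂`: there is no `B₂` term, and
the weights `w-r, …, w+r` average to `w`. Abel's identity then reads `θW = w(r+1) b E₂ W`
(`IsFundamentalSolution.hasDerivAt_wronskian`). The Darboux–Halphen system gives `θ log Δ = δ b E₂`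
(`IsHeckeHalphen.E2_eq_deriv_logBranch`), so `W Δ^(-w(r+1)/δ)` is constant on the connected set `ℍ`.
The constant is nonzero by uniqueness for linear systems
(`IsFundamentalSolution.wronskian_ne_zero`).

The delicate point is that `Δ` has no zeros or poles on `ℍ`; holomorphy of `E₂` and the existence of
`log Δ` follow from it. This is a local computation. The function `S = b E₂` satisfies `θS = S² - b²
(θJ/J)(θJ/(J-1))`, with `S` proportional to `θ log Δ`. Comparing coefficients of `(z-x)⁻²` gives a
quadratic relation between the orders of `J`, `J-1` and `Δ` at `x`
(`IsHeckeHalphen.order_relation`). In each possible configuration of orders it forces the order of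
`Δ` to be zero (`order_discriminant_eq_zero`). -/

/-- The logarithmic derivative of a meromorphic function has at most a simple pole, whose residue
is the order. -/
lemma exists_logDeriv_eq_div_add {f : ℂ → ℂ} {x : ℂ} {n : ℤ} (hf : MeromorphicAt f x)
    (hn : meromorphicOrderAt f x = n) :
    ∃ h : ℂ → ℂ, AnalyticAt ℂ h x ∧
      logDeriv f =ᶠ[𝓝[≠] x] fun z => n / (z - x) + h z := by
  obtain ⟨g, hg, hgx, hfg⟩ := (meromorphicOrderAt_eq_int_iff hf).1 hn
  refine ⟨logDeriv g, hg.deriv.div hg hgx, ?_⟩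
  refine (logDeriv_congr_nhdsNE hfg).trans ?_
  filter_upwards [self_mem_nhdsWithin,
    (hg.eventually_analyticAt.filter_mono nhdsWithin_le_nhds),
    (hg.continuousAt.eventually_ne hgx).filter_mono nhdsWithin_le_nhds] with z hz hgz hgz0
  have hzx : z - x ≠ 0 := sub_ne_zero.2 hz
  have hd : DifferentiableAt ℂ (fun z : ℂ => (z - x) ^ n) z :=
    (differentiableAt_id.sub_const x).zpow (Or.inl hzx)
  simp only [smul_eq_mul]
  rw [logDeriv_mul (f := fun z => (z - x) ^ n) z (zpow_ne_zero _ hzx) hgz0 hd hgz.differentiableAt,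
    logDeriv_fun_zpow (by fun_prop)]
  simp [logDeriv_apply, div_eq_mul_inv]

lemma tendsto_sub_mul_logDeriv {f : ℂ → ℂ} {x : ℂ} {n : ℤ} (hf : MeromorphicAt f x)
    (hn : meromorphicOrderAt f x = n) :
    Tendsto (fun z => (z - x) * logDeriv f z) (𝓝[≠] x) (𝓝 n) := by
  obtain ⟨h, hh, hfh⟩ := exists_logDeriv_eq_div_add hf hn
  have hc : ContinuousAt (fun z => (n : ℂ) + (z - x) * h z) x := by
    have := hh.continuousAt
    fun_prop
  have ht : Tendsto (fun z => (n : ℂ) + (z - x) * h z) (𝓝[≠] x) (𝓝 n) := by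
    simpa using hc.tendsto.mono_left nhdsWithin_le_nhds
  refine ht.congr' ?_
  filter_upwards [hfh, self_mem_nhdsWithin] with z hz hzx
  have : z - x ≠ 0 := sub_ne_zero.2 hzx
  rw [hz]
  field_simp

/-- The polar part `n/(z-x)` differentiates to `-n/(z-x)²`. Together with `tendsto_sub_mul_logDeriv`
this reads off double-pole coefficients in the Riccati equation. -/
lemma tendsto_sub_sq_mul_deriv_logDeriv {f : ℂ → ℂ} {x : ℂ} {n : ℤ} (hf : MeromorphicAt f x)
    (hn : meromorphicOrderAt f x = n) :
    Tendsto (fun z => (z - x) ^ 2 * deriv (logDeriv f) z) (𝓝[≠] x) (𝓝 (-n)) := by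
  obtain ⟨h, hh, hfh⟩ := exists_logDeriv_eq_div_add hf hn
  have hc : ContinuousAt (fun z => -(n : ℂ) + (z - x) ^ 2 * deriv h z) x := by
    have := hh.deriv.continuousAt
    fun_prop
  have ht : Tendsto (fun z => -(n : ℂ) + (z - x) ^ 2 * deriv h z) (𝓝[≠] x) (𝓝 (-n)) := by
    simpa using hc.tendsto.mono_left nhdsWithin_le_nhds
  refine ht.congr' ?_
  filter_upwards [hfh.nhdsNE_deriv, self_mem_nhdsWithin,
    (hh.eventually_analyticAt.filter_mono nhdsWithin_le_nhds)] with z hz hzx hhz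
  have h0 : z - x ≠ 0 := sub_ne_zero.2 hzx
  have hd : HasDerivAt (fun z => (n : ℂ) / (z - x) + h z)
      ((0 * (z - x) - n * 1) / (z - x) ^ 2 + deriv h z) z :=
    ((hasDerivAt_const z (n : ℂ)).div ((hasDerivAt_id z).sub_const x) h0).add
      hhz.differentiableAt.hasDerivAt
  rw [hz, hd.deriv]
  field_simp
  ring

/-! ### Constants -/

lemma width_ne_zero {μ : ℕ} (hμ : 3 ≤ μ) : width μ ≠ 0 := by
  have h3 : (3 : ℝ) ≤ μ := by exact_mod_cast hμ
  have : 0 < Real.cos (Real.pi / μ) := by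
    apply Real.cos_pos_of_mem_Ioo
    constructor
    · have := Real.pi_pos
      have : 0 < Real.pi / μ := by positivity
      linarith
    · apply div_lt_div_of_pos_left Real.pi_pos (by norm_num)
      linarith
  unfold width
  positivity

/-- The factor `ϖ / 2πi` in the Boole operator. -/
def thetaFactor (μ : ℕ) : ℂ := (width μ : ℂ) / (2 * Real.pi * I)

lemma theta_eq (μ : ℕ) (f : ℂ → ℂ) (z : ℂ) : theta μ f z = thetaFactor μ * deriv f z := rfl

lemma thetaFactor_ne_zero {μ : ℕ} (hμ : 3 ≤ μ) : thetaFactor μ ≠ 0 := by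
  have := width_ne_zero hμ
  have := Real.pi_ne_zero
  simp [thetaFactor, *]

lemma constB_eq {μ : ℕ} (hμ : 3 ≤ μ) : constB μ = ((μ : ℂ) - 2) / (4 * μ) := by
  have : (μ : ℂ) ≠ 0 := by exact_mod_cast (by omega : μ ≠ 0)
  unfold constB
  field_simp
  ring

lemma constB_ne_zero {μ : ℕ} (hμ : 3 ≤ μ) : constB μ ≠ 0 := by
  have h0 : (μ : ℂ) ≠ 0 := by exact_mod_cast (by omega : μ ≠ 0)
  have h2 : (μ : ℂ) - 2 ≠ 0 := by
    rw [sub_ne_zero]; exact_mod_cast (by omega : μ ≠ 2)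
  rw [constB_eq hμ]
  exact div_ne_zero h2 (mul_ne_zero (by norm_num) h0)

/-! ### Orders of the hauptmodul -/

/-- The indicial equation of the Riccati equation of `E₂` forces the order of the discriminant to
vanish. Here `p`, `s`, `x` are the orders of `J`, `J - 1`, `J'`. -/
lemma order_discriminant_eq_zero {μ N e p s x : ℤ} (hμ : 3 ≤ μ) (hN : 0 < N) (he : 2 * e = N * μ)
    (hcase : (0 < p ∧ s = 0 ∧ x = p - 1) ∨ (p = 0 ∧ 0 < s ∧ x = s - 1) ∨
      (p < 0 ∧ s = p ∧ x = p - 1) ∨ (p = 0 ∧ s = 0 ∧ 0 ≤ x))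
    {M : ℤ} (hM : M = N * μ * (x - p - s) + N * p + e * s)
    (hR : -4 * (2 * N * μ) * M = 4 * M ^ 2 - (N * (μ - 2)) ^ 2 * (p * s)) : M = 0 := by
  -- `m = 2M/N` is free of `e` and `N`; the relation becomes `m² + 4μm = (μ-2)² p s`.
  set m := 2 * μ * (x - p - s) + 2 * p + μ * s with hm
  have hMm : 2 * M = N * m := by rw [hM, hm]; linear_combination s * he
  have hR' : -4 * μ * m = m ^ 2 - (μ - 2) ^ 2 * (p * s) := by
    have h2 : N ^ 2 ≠ 0 := by positivity
    apply mul_left_cancel₀ h2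
    linear_combination hR + (-4 * N * μ - 2 * M - N * m) * (-hMm)
  have hm0 : m = 0 := by
    -- Away from poles `p s = 0`, so `m` is `0` or `-4μ`. The second root would require `p = -μ`, `s
    -- = -2` or `x = -2` in the respective cases.
    rcases hcase with ⟨hp, rfl, rfl⟩ | ⟨rfl, hs, rfl⟩ | ⟨hp, rfl, rfl⟩ | ⟨rfl, rfl, hx⟩
    · have : m * (m + 4 * μ) = 0 := by linear_combination -hR'
      rcases mul_eq_zero.1 this with h | h
      · exact h
      · nlinarith
    · have : m * (m + 4 * μ) = 0 := by linear_combination -hR'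
      rcases mul_eq_zero.1 this with h | h
      · exact h
      · nlinarith
    -- At a pole `m = -2μ - (μ-2)p`, hence `m² + 4μm = (μ-2)²p² - 4μ²`, which is never `(μ-2)²p²`:
    -- `J` has no poles on `ℍ`.
    · exfalso
      rw [hm] at hR'
      nlinarith
    · have : m * (m + 4 * μ) = 0 := by linear_combination -hR'
      rcases mul_eq_zero.1 this with h | h
      · exact h
      · nlinarith
  rw [hm0] at hMm
  omega

/-! ### The hauptmodul near a point of the upper half plane -/

lemma eventually_nhdsNE_of_codiscreteWithin {P : ℂ → Prop}
    (h : ∀ᶠ z in codiscreteWithin upperHalfPlaneSet, P z) {x : ℂ} (hx : x ∈ upperHalfPlaneSet) :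
    ∀ᶠ z in 𝓝[≠] x, P z := by
  have h1 := mem_codiscreteWithin_iff_forall_mem_nhdsNE.1 h x hx
  have h2 : ∀ᶠ z in 𝓝[≠] x, z ∈ upperHalfPlaneSet :=
    (isOpen_upperHalfPlaneSet.eventually_mem hx).filter_mono nhdsWithin_le_nhds
  filter_upwards [h1, h2] with z hz hz'
  exact hz.resolve_right fun h => h hz'

lemma isConnected_upperHalfPlaneSet : IsConnected upperHalfPlaneSet :=
  Complex.isConnected_of_upperHalfPlane (r := 0) subset_rfl (fun z (hz : 0 < z.im) => hz.le)

lemma I_mem_upperHalfPlaneSet : I ∈ upperHalfPlaneSet := by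
  simp [upperHalfPlaneSet]

lemma vertex_mem_upperHalfPlaneSet {μ : ℕ} (hμ : 3 ≤ μ) :
    -exp (-(Real.pi * I) / μ) ∈ upperHalfPlaneSet := by
  have h3 : (3 : ℝ) ≤ μ := by exact_mod_cast hμ
  have h : -(Real.pi * I) / μ = ((-(Real.pi / μ) : ℝ) : ℂ) * I := by
    push_cast; ring
  have hs : 0 < Real.sin (Real.pi / μ) := by
    apply Real.sin_pos_of_pos_of_lt_pi
    · have := Real.pi_pos
      positivity
    · exact div_lt_self Real.pi_pos (by linarith)
  change 0 < (-exp (-(Real.pi * I) / μ)).im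
  rw [h, neg_im, exp_ofReal_mul_I_im, Real.sin_neg, neg_neg]
  exact hs

variable {μ : ℕ} {y₁ y₂ y₃ : ℂ → ℂ}

lemma IsDarbouxHalphen.meromorphicOn_ratio (hy : IsDarbouxHalphen μ y₁ y₂ y₃) :
    MeromorphicOn (fun z => (y₃ z - y₂ z) / (y₃ z - y₁ z)) upperHalfPlaneSet := fun z hz =>
  ((hy.mero₃ z hz).sub (hy.mero₂ z hz)).div ((hy.mero₃ z hz).sub (hy.mero₁ z hz))

lemma meromorphicNFOn_hauptmodul (y₁ y₂ y₃ : ℂ → ℂ) :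
    MeromorphicNFOn (hauptmodul y₁ y₂ y₃) upperHalfPlaneSet :=
  meromorphicNFOn_toMeromorphicNFOn _ _

lemma IsDarbouxHalphen.hauptmodul_eventuallyEq (hy : IsDarbouxHalphen μ y₁ y₂ y₃) {x : ℂ}
    (hx : x ∈ upperHalfPlaneSet) :
    hauptmodul y₁ y₂ y₃ =ᶠ[𝓝[≠] x] fun z => (y₃ z - y₂ z) / (y₃ z - y₁ z) :=
  (hy.meromorphicOn_ratio.toMeromorphicNFOn_eq_self_on_nhdsNE hx)

/-- The hauptmodul is not constant near any point. -/
lemma IsHeckeHalphen.order_hauptmodul_sub_ne_top (hμ : 3 ≤ μ) (hy : IsHeckeHalphen μ y₁ y₂ y₃)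
    (c : ℂ) {x : ℂ} (hx : x ∈ upperHalfPlaneSet) :
    meromorphicOrderAt (fun z => hauptmodul y₁ y₂ y₃ z - c) x ≠ ⊤ := by
  intro htop
  have hJ := meromorphicNFOn_hauptmodul y₁ y₂ y₃
  have hm : MeromorphicOn (fun z => hauptmodul y₁ y₂ y₃ z - c) upperHalfPlaneSet := fun z hz =>
    (hJ hz).meromorphicAt.sub (MeromorphicAt.const c z)
  -- Infinite order spreads over the connected half plane, and the normal form turns equality near a
  -- point into equality at it. The values `1` and `0` at the two vertices then contradict
  -- constancy.
  have key : ∀ z ∈ upperHalfPlaneSet, hauptmodul y₁ y₂ y₃ z = c := by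
    intro z hz
    by_contra hne
    refine hm.meromorphicOrderAt_ne_top_of_isPreconnected
      isConnected_upperHalfPlaneSet.isPreconnected hz hx (fun hz_top => hne ?_) htop
    have h1 : hauptmodul y₁ y₂ y₃ =ᶠ[𝓝[≠] z] fun _ => c := by
      filter_upwards [meromorphicOrderAt_eq_top_iff.1 hz_top] with u hu
      exact sub_eq_zero.1 hu
    exact (((hJ hz).eventuallyEq_nhdsNE_iff_eventuallyEq_nhds
      analyticAt_const.meromorphicNFAt).1 h1).eq_of_nhds
  have h1 := key _ I_mem_upperHalfPlaneSet
  have h2 := key _ (vertex_mem_upperHalfPlaneSet hμ)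
  rw [hy.at_r₁] at h1
  rw [hy.at_r₂] at h2
  exact one_ne_zero (h1.trans h2.symm)

/-- `z` is a regular point of the Darboux-Halphen functions. -/
structure IsRegularPoint (μ : ℕ) (y₁ y₂ y₃ : ℂ → ℂ) (z : ℂ) : Prop where
  diff₁ : DifferentiableAt ℂ y₁ z
  diff₂ : DifferentiableAt ℂ y₂ z
  diff₃ : DifferentiableAt ℂ y₃ z
  eqn₁ : theta μ y₁ z = (constA μ - 1) * (y₁ z * y₂ z + y₁ z * y₃ z - y₂ z * y₃ z)
      + (constB μ + constC μ - 1) * y₁ z ^ 2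
  eqn₂ : theta μ y₂ z = (constB μ - 1) * (y₂ z * y₁ z + y₂ z * y₃ z - y₁ z * y₃ z)
      + (constA μ + constC μ - 1) * y₂ z ^ 2
  eqn₃ : theta μ y₃ z = (constC μ - 1) * (y₃ z * y₁ z + y₃ z * y₂ z - y₁ z * y₂ z)
      + (constA μ + constB μ - 1) * y₃ z ^ 2
  ne₃₁ : y₃ z - y₁ z ≠ 0
  ne₃₂ : y₃ z - y₂ z ≠ 0
  ne₁₂ : y₁ z - y₂ z ≠ 0

lemma IsHeckeHalphen.eventually_isRegularPoint (hμ : 3 ≤ μ) (hy : IsHeckeHalphen μ y₁ y₂ y₃)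
    {x : ℂ} (hx : x ∈ upperHalfPlaneSet) : ∀ᶠ z in 𝓝[≠] x, IsRegularPoint μ y₁ y₂ y₃ z := by
  have hJm := (meromorphicNFOn_hauptmodul y₁ y₂ y₃ hx).meromorphicAt
  have h0 : ∀ᶠ z in 𝓝[≠] x, hauptmodul y₁ y₂ y₃ z - 0 ≠ 0 :=
    (meromorphicOrderAt_ne_top_iff_eventually_ne_zero (hJm.sub (MeromorphicAt.const _ x))).1
      (hy.order_hauptmodul_sub_ne_top hμ 0 hx)
  have h1 : ∀ᶠ z in 𝓝[≠] x, hauptmodul y₁ y₂ y₃ z - 1 ≠ 0 :=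
    (meromorphicOrderAt_ne_top_iff_eventually_ne_zero (hJm.sub (MeromorphicAt.const _ x))).1
      (hy.order_hauptmodul_sub_ne_top hμ 1 hx)
  filter_upwards [h0, h1, hy.hauptmodul_eventuallyEq hx,
    eventually_nhdsNE_of_codiscreteWithin hy.eqn₁ hx,
    eventually_nhdsNE_of_codiscreteWithin hy.eqn₂ hx,
    eventually_nhdsNE_of_codiscreteWithin hy.eqn₃ hx,
    (hy.mero₁ x hx).eventually_analyticAt, (hy.mero₂ x hx).eventually_analyticAt,
    (hy.mero₃ x hx).eventually_analyticAt] with z h0 h1 hJ e1 e2 e3 a1 a2 a3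
  rw [hJ, sub_zero] at h0
  rw [hJ] at h1
  -- Since `x / 0 = 0`, a nonzero quotient also has a nonzero denominator.
  obtain ⟨h32, h31⟩ := div_ne_zero_iff.1 h0
  refine ⟨a1.differentiableAt, a2.differentiableAt, a3.differentiableAt, e1, e2, e3, h31, h32, ?_⟩
  intro h
  apply h1
  rw [sub_eq_zero, div_eq_one_iff_eq h31]
  linear_combination h

/-! ### Differential identities at regular points -/

section RegularPoint

variable {z : ℂ}

/-- By the system, `θ log` of a difference of two `yᵢ` is linear in the `yᵢ`; for numerator and
denominator these linear forms differ by `y₂ - y₁`. -/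
lemma IsRegularPoint.theta_ratio (h : IsRegularPoint μ y₁ y₂ y₃ z) :
    theta μ (fun z => (y₃ z - y₂ z) / (y₃ z - y₁ z)) z =
      (y₃ z - y₂ z) / (y₃ z - y₁ z) * (y₂ z - y₁ z) := by
  have hd := ((h.diff₃.hasDerivAt.sub h.diff₂.hasDerivAt).div
    (h.diff₃.hasDerivAt.sub h.diff₁.hasDerivAt) h.ne₃₁).deriv
  have e1 := h.eqn₁
  have e2 := h.eqn₂
  have e3 := h.eqn₃
  rw [theta_eq] at e1 e2 e3 ⊢
  have h31 := h.ne₃₁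
  erw [hd]
  simp only [Pi.sub_apply]
  field_simp
  linear_combination (y₃ z - y₁ z) * (e3 - e2) - (y₃ z - y₂ z) * (e3 - e1)

/-- `E₂` up to the factor `b`. -/
def scaledE2 (μ : ℕ) (y₁ y₂ y₃ : ℂ → ℂ) (z : ℂ) : ℂ :=
  (constB μ - constA μ) * y₁ z - constB μ * y₂ z + (constB μ + constA μ - 1) * y₃ z

/-- The Riccati equation of `E₂`. -/
lemma IsRegularPoint.theta_scaledE2 (h : IsRegularPoint μ y₁ y₂ y₃ z) :
    theta μ (scaledE2 μ y₁ y₂ y₃) z = scaledE2 μ y₁ y₂ y₃ z ^ 2 -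
      constB μ ^ 2 * ((y₂ z - y₁ z) * (y₂ z - y₃ z)) := by
  have hd := ((((h.diff₁.hasDerivAt).const_mul (constB μ - constA μ)).sub
    ((h.diff₂.hasDerivAt).const_mul (constB μ))).add
    ((h.diff₃.hasDerivAt).const_mul (constB μ + constA μ - 1))).deriv
  have e1 := h.eqn₁
  have e2 := h.eqn₂
  have e3 := h.eqn₃
  have hc : theta μ (scaledE2 μ y₁ y₂ y₃) z = (constB μ - constA μ) * theta μ y₁ z
      - constB μ * theta μ y₂ z + (constB μ + constA μ - 1) * theta μ y₃ z := by
    rw [theta_eq, theta_eq, theta_eq, theta_eq]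
    erw [hd]
    ring
  rw [hc, e1, e2, e3]
  -- Two quadratic forms in the `yᵢ`; their coefficients agree because `a + c = 1`.
  unfold scaledE2 constA constB constC
  ring

end RegularPoint

/-! ### The discriminant -/

/-- The discriminant before singularities are removed, with the cases of even and odd `μ` unified
by `N ∈ {1, 2}` and `2 e = N μ`. -/
def rawDiscriminant (μ N e : ℕ) (J : ℂ → ℂ) (x : ℂ) : ℂ :=
  (theta μ J x / (J x * (J x - 1))) ^ (N * μ) * J x ^ N * (J x - 1) ^ e

/-- Here `N = lcm(2, μ)/μ`, so that `Nμ` is even and `e = Nμ/2` is an integer. -/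
lemma exists_discriminant_eq (μ : ℕ) : ∃ N e : ℕ, 0 < N ∧ 2 * e = N * μ ∧
    delta μ = 2 * (N * μ) ∧ ∀ (J : ℂ → ℂ) (z : ℍ), discriminant μ J z =
      toMeromorphicNFOn (rawDiscriminant μ N e J) upperHalfPlaneSet z := by
  by_cases h : Even μ
  · refine ⟨1, μ / 2, one_pos, ?_, ?_, fun J z => ?_⟩
    · rw [Nat.mul_div_cancel' h.two_dvd, one_mul]
    · rw [delta, Nat.lcm_eq_right h.two_dvd, one_mul]
    · unfold discriminant rawDiscriminant
      simp only [h, if_true, one_mul, pow_one]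
  · refine ⟨2, μ, two_pos, rfl, ?_, fun J z => ?_⟩
    · rw [delta, Nat.Coprime.lcm_eq_mul]
      exact (Nat.coprime_two_left).2 (Nat.not_even_iff_odd.1 h)
    · unfold discriminant rawDiscriminant
      simp only [h, if_false]

lemma IsRegularPoint.logDeriv_product {N e : ℕ} {z : ℂ} (hμ : 3 ≤ μ) (he : 2 * e = N * μ)
    (h : IsRegularPoint μ y₁ y₂ y₃ z) :
    thetaFactor μ * logDeriv (fun z => (y₁ z - y₃ z) ^ (N * μ) *
      ((y₃ z - y₂ z) / (y₃ z - y₁ z)) ^ N * ((y₁ z - y₂ z) / (y₃ z - y₁ z)) ^ e) z =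
      2 * N * μ * scaledE2 μ y₁ y₂ y₃ z := by
  have h31 := h.ne₃₁
  have h32 := h.ne₃₂
  have h12 := h.ne₁₂
  have d1 := h.diff₁
  have d2 := h.diff₂
  have d3 := h.diff₃
  have h13 : y₁ z - y₃ z ≠ 0 := by rw [← neg_sub]; exact neg_ne_zero.2 h31
  have d13 : DifferentiableAt ℂ (fun z => y₁ z - y₃ z) z := d1.sub d3
  have d31 : DifferentiableAt ℂ (fun z => y₃ z - y₁ z) z := d3.sub d1
  have d32 : DifferentiableAt ℂ (fun z => y₃ z - y₂ z) z := d3.sub d2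
  have d12 : DifferentiableAt ℂ (fun z => y₁ z - y₂ z) z := d1.sub d2
  have dJ : DifferentiableAt ℂ (fun z => (y₃ z - y₂ z) / (y₃ z - y₁ z)) z := d32.div d31 h31
  have dK : DifferentiableAt ℂ (fun z => (y₁ z - y₂ z) / (y₃ z - y₁ z)) z := d12.div d31 h31
  have hJ0 : (y₃ z - y₂ z) / (y₃ z - y₁ z) ≠ 0 := div_ne_zero h32 h31
  have hK0 : (y₁ z - y₂ z) / (y₃ z - y₁ z) ≠ 0 := div_ne_zero h12 h31
  rw [logDeriv_mul (f := fun z => (y₁ z - y₃ z) ^ (N * μ) * ((y₃ z - y₂ z) / (y₃ z - y₁ z)) ^ N)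
      (g := fun z => ((y₁ z - y₂ z) / (y₃ z - y₁ z)) ^ e) z
      (mul_ne_zero (pow_ne_zero _ h13) (pow_ne_zero _ hJ0)) (pow_ne_zero _ hK0)
      ((d13.pow _).mul (dJ.pow _)) (dK.pow _),
    logDeriv_mul (f := fun z => (y₁ z - y₃ z) ^ (N * μ))
      (g := fun z => ((y₃ z - y₂ z) / (y₃ z - y₁ z)) ^ N) z
      (pow_ne_zero _ h13) (pow_ne_zero _ hJ0) (d13.pow _) (dJ.pow _),
    logDeriv_fun_pow d13, logDeriv_fun_pow dJ, logDeriv_fun_pow dK,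
    logDeriv_div (f := fun z => y₃ z - y₂ z) (g := fun z => y₃ z - y₁ z) z h32 h31 d32 d31,
    logDeriv_div (f := fun z => y₁ z - y₂ z) (g := fun z => y₃ z - y₁ z) z h12 h31 d12 d31]
  have e1 := h.eqn₁
  have e2 := h.eqn₂
  have e3 := h.eqn₃
  rw [theta_eq] at e1 e2 e3
  have l13 : thetaFactor μ * logDeriv (fun z => y₁ z - y₃ z) z =
      (constA μ + constB μ - 1) * y₃ z + (constB μ + constC μ - 1) * y₁ z
        + (constA μ + constC μ - 2) * y₂ z := by
    rw [logDeriv_apply, deriv_fun_sub d1 d3, mul_div_assoc', div_eq_iff h13]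
    linear_combination e1 - e3
  have l31 : thetaFactor μ * logDeriv (fun z => y₃ z - y₁ z) z =
      (constA μ + constB μ - 1) * y₃ z + (constB μ + constC μ - 1) * y₁ z
        + (constA μ + constC μ - 2) * y₂ z := by
    rw [logDeriv_apply, deriv_fun_sub d3 d1, mul_div_assoc', div_eq_iff h31]
    linear_combination e3 - e1
  have l32 : thetaFactor μ * logDeriv (fun z => y₃ z - y₂ z) z =
      (constA μ + constB μ - 1) * y₃ z + (constA μ + constC μ - 1) * y₂ z
        + (constB μ + constC μ - 2) * y₁ z := by
    rw [logDeriv_apply, deriv_fun_sub d3 d2, mul_div_assoc', div_eq_iff h32]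
    linear_combination e3 - e2
  have l12 : thetaFactor μ * logDeriv (fun z => y₁ z - y₂ z) z =
      (constB μ + constC μ - 1) * y₁ z + (constA μ + constC μ - 1) * y₂ z
        + (constA μ + constB μ - 2) * y₃ z := by
    rw [logDeriv_apply, deriv_fun_sub d1 d2, mul_div_assoc', div_eq_iff h12]
    linear_combination e1 - e2
  have he' : (e : ℂ) = N * μ / 2 := by
    have : (2 * e : ℂ) = N * μ := by exact_mod_cast he
    linear_combination this / 2
  have hμ0 : (μ : ℂ) ≠ 0 := by exact_mod_cast (by omega : μ ≠ 0)
  have hexp : ∀ κ A B C D : ℂ, κ * (((N * μ : ℕ) : ℂ) * A + N * (B - C) + e * (D - C)) =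
      N * μ * (κ * A) + N * (κ * B - κ * C) + N * μ / 2 * (κ * D - κ * C) := by
    intro κ A B C D
    rw [he']
    push_cast
    ring
  rw [hexp, l13, l31, l32, l12]
  unfold scaledE2 constA constB constC
  field_simp
  ring

variable {N e : ℕ}

/-- From `θJ = J(y₂ - y₁)` and `J - 1 = (y₁ - y₂)/(y₃ - y₁)`, the quotient `θJ/(J(J-1))` collapses
to `y₁ - y₃`. -/
lemma IsHeckeHalphen.rawDiscriminant_eventuallyEq (hμ : 3 ≤ μ) (hy : IsHeckeHalphen μ y₁ y₂ y₃)
    {x : ℂ} (hx : x ∈ upperHalfPlaneSet) :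
    rawDiscriminant μ N e (hauptmodul y₁ y₂ y₃) =ᶠ[𝓝[≠] x] fun z => (y₁ z - y₃ z) ^ (N * μ) *
      ((y₃ z - y₂ z) / (y₃ z - y₁ z)) ^ N * ((y₁ z - y₂ z) / (y₃ z - y₁ z)) ^ e := by
  have hJ := hy.hauptmodul_eventuallyEq hx
  filter_upwards [hJ, hJ.nhdsNE_deriv, hy.eventually_isRegularPoint hμ hx] with z hz hdz h
  have h31 := h.ne₃₁
  have h32 := h.ne₃₂
  have h12 := h.ne₁₂
  have hK : (y₃ z - y₂ z) / (y₃ z - y₁ z) - 1 = (y₁ z - y₂ z) / (y₃ z - y₁ z) := by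
    field_simp
    ring
  have hX : theta μ (hauptmodul y₁ y₂ y₃) z / ((y₃ z - y₂ z) / (y₃ z - y₁ z) *
      ((y₃ z - y₂ z) / (y₃ z - y₁ z) - 1)) = y₁ z - y₃ z := by
    rw [theta_eq, hdz, ← theta_eq, h.theta_ratio, hK]
    field_simp
    ring
  rw [rawDiscriminant, hz, hX, hK]

lemma IsHeckeHalphen.logDeriv_rawDiscriminant (hμ : 3 ≤ μ) (hy : IsHeckeHalphen μ y₁ y₂ y₃)
    (he : 2 * e = N * μ) {x : ℂ} (hx : x ∈ upperHalfPlaneSet) :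
    (fun z => thetaFactor μ * logDeriv (rawDiscriminant μ N e (hauptmodul y₁ y₂ y₃)) z)
      =ᶠ[𝓝[≠] x] fun z => 2 * N * μ * scaledE2 μ y₁ y₂ y₃ z := by
  filter_upwards [logDeriv_congr_nhdsNE (hy.rawDiscriminant_eventuallyEq (N := N) (e := e) hμ hx),
    hy.eventually_isRegularPoint hμ hx] with z hz h
  rw [hz, h.logDeriv_product hμ he]

lemma meromorphicOn_rawDiscriminant (y₁ y₂ y₃ : ℂ → ℂ) :
    MeromorphicOn (rawDiscriminant μ N e (hauptmodul y₁ y₂ y₃)) upperHalfPlaneSet := by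
  intro x hx
  have hJ := (meromorphicNFOn_hauptmodul y₁ y₂ y₃ hx).meromorphicAt
  have hJ1 := hJ.sub (MeromorphicAt.const (1 : ℂ) x)
  exact (((((MeromorphicAt.const (thetaFactor μ) x).mul hJ.deriv).div (hJ.mul hJ1)).pow _).mul
    (hJ.pow _)).mul (hJ1.pow _)

/-! ### Local orders of `J` and of the discriminant -/

/-- The possible orders of `J`, `J - 1`, `J'` at a point where the meromorphic function `J` is not
constant. -/
lemma exists_orders {J : ℂ → ℂ} {x : ℂ} (hJ : MeromorphicAt J x)
    (hne : ∀ c, meromorphicOrderAt (fun z => J z - c) x ≠ ⊤) :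
    ∃ p s n : ℤ, meromorphicOrderAt J x = p ∧ meromorphicOrderAt (fun z => J z - 1) x = s ∧
      meromorphicOrderAt (deriv J) x = n ∧
      ((0 < p ∧ s = 0 ∧ n = p - 1) ∨ (p = 0 ∧ 0 < s ∧ n = s - 1) ∨
        (p < 0 ∧ s = p ∧ n = p - 1) ∨ (p = 0 ∧ s = 0 ∧ 0 ≤ n)) := by
  have h0 : meromorphicOrderAt J x ≠ ⊤ := by simpa using hne 0
  obtain ⟨p, hp⟩ := WithTop.ne_top_iff_exists.1 h0
  obtain ⟨s, hs⟩ := WithTop.ne_top_iff_exists.1 (hne 1)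
  have hJ1 : MeromorphicAt (fun z => J z - 1) x := hJ.sub (MeromorphicAt.const 1 x)
  have hd1 : deriv (fun z => J z - 1) = deriv J := by
    funext z
    exact deriv_sub_const 1
  -- If `p ≠ 0`, differentiation lowers the order by one. If `p = 0`, vanishing of `J'` near `x`
  -- would make the analytic extension, hence `J`, locally constant.
  have hdn : meromorphicOrderAt (deriv J) x ≠ ⊤ := by
    intro htop
    by_cases h : p = 0
    · obtain ⟨g, hg, hgJ⟩ := hJ.meromorphicOrderAt_nonneg_iff.1 (by rw [← hp, h]; simp)
      rw [meromorphicOrderAt_congr hgJ.nhdsNE_deriv, hg.deriv.meromorphicOrderAt_eq,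
        ENat.map_eq_top_iff] at htop
      have h1 := hg.analyticOrderAt_deriv_add_one
      rw [htop, top_add] at h1
      apply hne (g x)
      rw [meromorphicOrderAt_eq_top_iff]
      filter_upwards [hgJ, (analyticOrderAt_eq_top.1 h1.symm).filter_mono nhdsWithin_le_nhds]
        with z hz hz'
      rw [hz, hz']
    · rw [meromorphicOrderAt_deriv_eq_sub_one (n := p) (by exact_mod_cast h) hp.symm] at htop
      exact WithTop.coe_ne_top htop
  obtain ⟨n, hn⟩ := WithTop.ne_top_iff_exists.1 hdn
  have hnp : p ≠ 0 → n = p - 1 := fun h => by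
    have := meromorphicOrderAt_deriv_eq_sub_one (n := p) (by exact_mod_cast h) hp.symm
    rw [← hn] at this
    exact_mod_cast this
  have hns : s ≠ 0 → n = s - 1 := fun h => by
    have := meromorphicOrderAt_deriv_eq_sub_one (n := s) (by exact_mod_cast h) hs.symm
    rw [hd1, ← hn] at this
    exact_mod_cast this
  have hc : meromorphicOrderAt (fun _ : ℂ => (-1 : ℂ)) x = (0 : ℤ) := by
    classical
    rw [meromorphicOrderAt_const]; simp
  have hsum : (fun z => J z - 1) = J + fun _ => (-1 : ℂ) := by
    funext z; simp [sub_eq_add_neg]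
  have hmin : p ≠ 0 → s = min p 0 := fun h => by
    have := meromorphicOrderAt_add_of_ne hJ (MeromorphicAt.const (-1 : ℂ) x)
      (by rw [← hp, hc]; exact_mod_cast h)
    rw [← hsum, ← hs, ← hp, hc] at this
    exact_mod_cast this
  have hs0 : p = 0 → 0 ≤ s := fun h => by
    have := meromorphicOrderAt_add hJ (MeromorphicAt.const (-1 : ℂ) x)
    rw [← hsum, ← hs, ← hp, hc, h] at this
    simpa using this
  refine ⟨p, s, n, hp.symm, hs.symm, hn.symm, ?_⟩
  rcases lt_trichotomy p 0 with h | h | h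
  · have := hmin h.ne
    rw [min_eq_left h.le] at this
    exact Or.inr (Or.inr (Or.inl ⟨h, this, hnp h.ne⟩))
  · rcases (hs0 h).eq_or_lt with h' | h'
    · refine Or.inr (Or.inr (Or.inr ⟨h, h'.symm, ?_⟩))
      obtain ⟨g, hg, hgJ⟩ := hJ.meromorphicOrderAt_nonneg_iff.1 (by rw [← hp, h]; simp)
      have := hg.deriv.meromorphicOrderAt_nonneg
      rw [← meromorphicOrderAt_congr hgJ.nhdsNE_deriv, ← hn] at this
      exact_mod_cast this
    · exact Or.inr (Or.inl ⟨h, h', hns h'.ne'⟩)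
  · have := hmin h.ne'
    rw [min_eq_right h.le] at this
    exact Or.inl ⟨h, this, hnp h.ne'⟩

/-- The Riccati equation of `E₂`, as a relation between the orders at a point. -/
lemma IsHeckeHalphen.order_relation (hμ : 3 ≤ μ) (hy : IsHeckeHalphen μ y₁ y₂ y₃)
    (hN : 0 < N) (he : 2 * e = N * μ) {x : ℂ} (hx : x ∈ upperHalfPlaneSet) {p s M : ℤ}
    (hp : meromorphicOrderAt (hauptmodul y₁ y₂ y₃) x = p)
    (hs : meromorphicOrderAt (fun z => hauptmodul y₁ y₂ y₃ z - 1) x = s)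
    (hM : meromorphicOrderAt (rawDiscriminant μ N e (hauptmodul y₁ y₂ y₃)) x = M) :
    -4 * (2 * N * μ) * M = 4 * M ^ 2 - (N * (μ - 2)) ^ 2 * (p * s) := by
  set J := hauptmodul y₁ y₂ y₃
  set P := rawDiscriminant μ N e J
  set κ := thetaFactor μ
  have hκ : κ ≠ 0 := thetaFactor_ne_zero hμ
  have hμ0 : (μ : ℂ) ≠ 0 := by exact_mod_cast (by omega : μ ≠ 0)
  have hN0 : (N : ℂ) ≠ 0 := by exact_mod_cast hN.ne'
  have hJ : MeromorphicAt J x := (meromorphicNFOn_hauptmodul y₁ y₂ y₃ hx).meromorphicAt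
  have hJ1 : MeromorphicAt (fun z => J z - 1) x := hJ.sub (MeromorphicAt.const 1 x)
  have hP : MeromorphicAt P x := meromorphicOn_rawDiscriminant y₁ y₂ y₃ x hx
  have hS : scaledE2 μ y₁ y₂ y₃ =ᶠ[𝓝[≠] x] fun z => κ / (2 * N * μ) * logDeriv P z := by
    filter_upwards [hy.logDeriv_rawDiscriminant (N := N) hμ he hx] with z hz
    rw [div_mul_eq_mul_div, hz]
    field_simp
  have hJr : J =ᶠ[𝓝[≠] x] fun z => (y₃ z - y₂ z) / (y₃ z - y₁ z) :=
    hy.hauptmodul_eventuallyEq hx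
  -- The Riccati equation multiplied by `(z-x)²/κ²`, with `y₂ - y₁` and `y₂ - y₃` recognized as `θ
  -- log J` and `θ log (J-1)`. Both sides have limits at `x`.
  have hev : (fun z => (z - x) ^ 2 * deriv (logDeriv P) z / (2 * N * μ)) =ᶠ[𝓝[≠] x]
      fun z => ((z - x) * logDeriv P z) ^ 2 / (2 * N * μ) ^ 2 - constB μ ^ 2 *
        (((z - x) * logDeriv J z) * ((z - x) * logDeriv (fun z => J z - 1) z)) := by
    filter_upwards [hS, hS.nhdsNE_deriv, hJr, hJr.nhdsNE_deriv,
      hy.eventually_isRegularPoint hμ hx] with z hSz hdSz hJz hdJz h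
    have hR := h.theta_scaledE2
    rw [theta_eq, hdSz, hSz, deriv_const_mul_field] at hR
    have h31 := h.ne₃₁
    have h32 := h.ne₃₂
    have h12 := h.ne₁₂
    have hT := h.theta_ratio
    rw [theta_eq, ← hdJz] at hT
    have l0 : κ * logDeriv J z = y₂ z - y₁ z := by
      rw [logDeriv_apply, hJz, mul_div_assoc', hT]
      field_simp
    have l1 : κ * logDeriv (fun z => J z - 1) z = y₂ z - y₃ z := by
      have hK : (y₃ z - y₂ z) / (y₃ z - y₁ z) - 1 = (y₁ z - y₂ z) / (y₃ z - y₁ z) := by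
        field_simp
        ring
      rw [logDeriv_apply, deriv_sub_const, hJz, mul_div_assoc', hT, hK]
      field_simp
      ring
    rw [← l0, ← l1] at hR
    apply mul_left_cancel₀ (pow_ne_zero 2 hκ)
    linear_combination (z - x) ^ 2 * hR
  have hL := ((tendsto_sub_sq_mul_deriv_logDeriv hP hM).div_const (2 * N * μ : ℂ)).congr' hev
  have hR := (((tendsto_sub_mul_logDeriv hP hM).pow 2).div_const ((2 * N * μ : ℂ) ^ 2)).sub
    (((tendsto_sub_mul_logDeriv hJ hp).mul (tendsto_sub_mul_logDeriv hJ1 hs)).const_mul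
      (constB μ ^ 2))
  have heq := tendsto_nhds_unique hL hR
  rw [constB_eq hμ] at heq
  field_simp at heq
  have hC : (-4 * (2 * N * μ) * M : ℂ) = 4 * M ^ 2 - (N * (μ - 2)) ^ 2 * (p * s) := by
    linear_combination heq / 4
  exact_mod_cast hC

/-- The discriminant has neither zeros nor poles on the upper half plane. -/
lemma IsHeckeHalphen.order_rawDiscriminant (hμ : 3 ≤ μ) (hy : IsHeckeHalphen μ y₁ y₂ y₃)
    (hN : 0 < N) (he : 2 * e = N * μ) {x : ℂ} (hx : x ∈ upperHalfPlaneSet) :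
    meromorphicOrderAt (rawDiscriminant μ N e (hauptmodul y₁ y₂ y₃)) x = 0 := by
  have hJ := (meromorphicNFOn_hauptmodul y₁ y₂ y₃ hx).meromorphicAt
  have hJ1 : MeromorphicAt (fun z => hauptmodul y₁ y₂ y₃ z - 1) x :=
    hJ.sub (MeromorphicAt.const (1 : ℂ) x)
  obtain ⟨p, s, n, hp, hs, hn, hcase⟩ :=
    exists_orders hJ fun c => hy.order_hauptmodul_sub_ne_top hμ c hx
  have hθ : meromorphicOrderAt (theta μ (hauptmodul y₁ y₂ y₃)) x = n := by
    rw [← hn]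
    exact meromorphicOrderAt_mul_of_ne_zero (f := deriv (hauptmodul y₁ y₂ y₃))
      (g := fun _ => thetaFactor μ) analyticAt_const (thetaFactor_ne_zero hμ)
  have hθm : MeromorphicAt (theta μ (hauptmodul y₁ y₂ y₃)) x :=
    (MeromorphicAt.const (thetaFactor μ) x).mul hJ.deriv
  have hM : meromorphicOrderAt (rawDiscriminant μ N e (hauptmodul y₁ y₂ y₃)) x =
      ((N * μ * (n - p - s) + N * p + e * s : ℤ) : WithTop ℤ) := by
    change meromorphicOrderAt ((theta μ (hauptmodul y₁ y₂ y₃) / (hauptmodul y₁ y₂ y₃ *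
      fun z => hauptmodul y₁ y₂ y₃ z - 1)) ^ (N * μ) * hauptmodul y₁ y₂ y₃ ^ N *
      (fun z => hauptmodul y₁ y₂ y₃ z - 1) ^ e) x = _
    rw [meromorphicOrderAt_mul (((hθm.div (hJ.mul hJ1)).pow _).mul (hJ.pow _)) (hJ1.pow _),
      meromorphicOrderAt_mul ((hθm.div (hJ.mul hJ1)).pow _) (hJ.pow _),
      meromorphicOrderAt_pow (hθm.div (hJ.mul hJ1)), meromorphicOrderAt_pow hJ,
      meromorphicOrderAt_pow hJ1, meromorphicOrderAt_div hθm (hJ.mul hJ1),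
      meromorphicOrderAt_mul hJ hJ1, hp, hs, hθ, sub_sub]
    push_cast
    norm_cast
  have hrel := hy.order_relation hμ hN he hx hp hs hM
  rw [hM, order_discriminant_eq_zero (μ := μ) (N := N) (e := e) (by exact_mod_cast hμ)
    (by exact_mod_cast hN) (by exact_mod_cast he) hcase rfl hrel]
  rfl

/-! ### Holomorphic functions on the upper half plane -/

lemma mdiff_of_differentiableAt {f : ℍ → ℂ} {F : ℂ → ℂ}
    (hF : ∀ z ∈ upperHalfPlaneSet, DifferentiableAt ℂ F z) (hf : ∀ z : ℍ, f z = F z) : MDiff f := by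
  rw [UpperHalfPlane.mdifferentiable_iff]
  intro z hz
  refine ((hF z hz).congr_of_eventuallyEq ?_).differentiableWithinAt
  filter_upwards [isOpen_upperHalfPlaneSet.mem_nhds hz] with u hu
  simp [hf, ofComplex_apply_of_im_pos hu]

/-! ### Logarithms of holomorphic functions on the upper half plane -/

lemma isSimplyConnected_upperHalfPlaneSet : IsSimplyConnected upperHalfPlaneSet := by
  have : ContractibleSpace upperHalfPlaneSet :=
    Convex.contractibleSpace (convex_halfSpace_im_gt 0) ⟨I, I_mem_upperHalfPlaneSet⟩
  exact inferInstanceAs (SimplyConnectedSpace upperHalfPlaneSet)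

/-- A continuous logarithm of a holomorphic function is holomorphic. -/
lemma differentiableAt_of_exp_eq {f g : ℂ → ℂ} {x : ℂ} (hf : ContinuousAt f x)
    (hg : DifferentiableAt ℂ g x) (h : ∀ᶠ z in 𝓝 x, exp (f z) = g z) :
    DifferentiableAt ℂ f x := by
  have him : ContinuousAt (fun z => (f z - f x).im) x :=
    continuous_im.continuousAt.comp (hf.sub continuousAt_const)
  have hx : exp (f x) = g x := h.self_of_nhds
  -- Near `x` the imaginary part of `f z - f x` stays in `(-π, π)`, where the principal logarithm
  -- inverts `exp`.
  have hev : f =ᶠ[𝓝 x] fun z => f x + log (g z / g x) := by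
    have hmem : ∀ᶠ z in 𝓝 x, (f z - f x).im ∈ Set.Ioo (-Real.pi) Real.pi :=
      him.eventually_mem (Ioo_mem_nhds (by simp [Real.pi_pos]) (by simp [Real.pi_pos]))
    filter_upwards [hmem, h] with z hz hgz
    rw [← hgz, ← hx, ← exp_sub, log_exp hz.1 hz.2.le]
    ring
  refine DifferentiableAt.congr_of_eventuallyEq ?_ hev
  have hgx : g x ≠ 0 := hx ▸ exp_ne_zero _
  refine (DifferentiableAt.clog (hg.div_const _) ?_).const_add _
  rw [div_self hgx]
  exact one_mem_slitPlane

lemma exists_isLogBranch {f : ℍ → ℂ} {F : ℂ → ℂ} (hF : AnalyticOnNhd ℂ F upperHalfPlaneSet)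
    (hF0 : ∀ z ∈ upperHalfPlaneSet, F z ≠ 0) (hf : ∀ z : ℍ, f z = F z) :
    ∃ L : ℍ → ℂ, IsLogBranch L f := by
  obtain ⟨L, hLc, hL⟩ := exists_continuousOn_eqOn_exp_comp isSimplyConnected_upperHalfPlaneSet
    isOpen_upperHalfPlaneSet hF.continuousOn (by rintro ⟨z, hz, h⟩; exact hF0 z hz h)
  refine ⟨fun z => L z, ?_, fun z => ?_⟩
  · refine mdiff_of_differentiableAt (F := L) (fun z hz => ?_) fun _ => rfl
    have hnhds : upperHalfPlaneSet ∈ 𝓝 z := isOpen_upperHalfPlaneSet.mem_nhds hz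
    exact differentiableAt_of_exp_eq (hLc.continuousAt hnhds) (hF z hz).differentiableAt
      (by filter_upwards [hnhds] with u hu using hL hu)
  · rw [hf]
    exact hL z.2

/-! ### The discriminant and `E₂` on the upper half plane -/

lemma IsHeckeHalphen.analyticOnNhd_discriminant (hμ : 3 ≤ μ) (hy : IsHeckeHalphen μ y₁ y₂ y₃)
    (hN : 0 < N) (he : 2 * e = N * μ) :
    AnalyticOnNhd ℂ (toMeromorphicNFOn (rawDiscriminant μ N e (hauptmodul y₁ y₂ y₃))
      upperHalfPlaneSet) upperHalfPlaneSet := by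
  intro x hx
  have hm := meromorphicOn_rawDiscriminant (μ := μ) (N := N) (e := e) y₁ y₂ y₃
  apply (meromorphicNFOn_toMeromorphicNFOn _ _ hx).meromorphicOrderAt_nonneg_iff_analyticAt.1
  rw [meromorphicOrderAt_toMeromorphicNFOn hm hx, hy.order_rawDiscriminant hμ hN he hx]

lemma IsHeckeHalphen.discriminant_ne_zero (hμ : 3 ≤ μ) (hy : IsHeckeHalphen μ y₁ y₂ y₃)
    (hN : 0 < N) (he : 2 * e = N * μ) {x : ℂ} (hx : x ∈ upperHalfPlaneSet) :
    toMeromorphicNFOn (rawDiscriminant μ N e (hauptmodul y₁ y₂ y₃)) upperHalfPlaneSet x ≠ 0 := by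
  have hm := meromorphicOn_rawDiscriminant (μ := μ) (N := N) (e := e) y₁ y₂ y₃
  apply (meromorphicNFOn_toMeromorphicNFOn _ _ hx).meromorphicOrderAt_eq_zero_iff.1
  rw [meromorphicOrderAt_toMeromorphicNFOn hm hx, hy.order_rawDiscriminant hμ hN he hx]

/-- `E₂` is, up to a constant, the logarithmic derivative of the discriminant. -/
lemma IsHeckeHalphen.E2_eq (hμ : 3 ≤ μ) (hy : IsHeckeHalphen μ y₁ y₂ y₃)
    (hN : 0 < N) (he : 2 * e = N * μ) (z : ℍ) :
    E2 μ y₁ y₂ y₃ z = thetaFactor μ / (2 * N * μ * constB μ) *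
      logDeriv (toMeromorphicNFOn (rawDiscriminant μ N e (hauptmodul y₁ y₂ y₃))
        upperHalfPlaneSet) z := by
  have hm := meromorphicOn_rawDiscriminant (μ := μ) (N := N) (e := e) y₁ y₂ y₃
  set D := toMeromorphicNFOn (rawDiscriminant μ N e (hauptmodul y₁ y₂ y₃)) upperHalfPlaneSet
  have hz : (z : ℂ) ∈ upperHalfPlaneSet := z.2
  have hD : AnalyticAt ℂ D z := hy.analyticOnNhd_discriminant hμ hN he z hz
  have hlog : AnalyticAt ℂ (fun x => thetaFactor μ / (2 * N * μ * constB μ) * logDeriv D x) z :=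
    analyticAt_const.mul (hD.deriv.div hD (hy.discriminant_ne_zero hμ hN he hz))
  have hE : MeromorphicOn (fun x => 1 / constB μ * ((constB μ - constA μ) * y₁ x
      - constB μ * y₂ x + (constB μ + constA μ - 1) * y₃ x)) upperHalfPlaneSet := fun x hx =>
    (MeromorphicAt.const _ x).mul ((((MeromorphicAt.const _ x).mul (hy.mero₁ x hx)).sub
      ((MeromorphicAt.const _ x).mul (hy.mero₂ x hx))).add
      ((MeromorphicAt.const _ x).mul (hy.mero₃ x hx)))
  -- Both sides are in normal form at `z`, so agreement on a punctured neighbourhood suffices.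
  refine (((meromorphicNFOn_toMeromorphicNFOn _ _ hz).eventuallyEq_nhdsNE_iff_eventuallyEq_nhds
    hlog.meromorphicNFAt).1 ?_).eq_of_nhds
  have hμ0 : (μ : ℂ) ≠ 0 := by exact_mod_cast (by omega : μ ≠ 0)
  have hN0 : (N : ℂ) ≠ 0 := by exact_mod_cast hN.ne'
  have hb := constB_ne_zero hμ
  filter_upwards [hE.toMeromorphicNFOn_eq_self_on_nhdsNE hz,
    logDeriv_congr_nhdsNE (hm.toMeromorphicNFOn_eq_self_on_nhdsNE hz),
    hy.logDeriv_rawDiscriminant (N := N) hμ he hz] with x hx hDx hS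
  have hS' : thetaFactor μ * logDeriv D x = 2 * N * μ * ((constB μ - constA μ) * y₁ x
      - constB μ * y₂ x + (constB μ + constA μ - 1) * y₃ x) := by
    rw [hDx]
    exact hS
  rw [hx, div_mul_eq_mul_div (thetaFactor μ), hS']
  field_simp

/-! ### Linear differential systems -/

lemma hasDerivAt_det {n : Type*} [Fintype n] [DecidableEq n] {M : ℂ → Matrix n n ℂ}
    {M' : Matrix n n ℂ} {x : ℂ} (h : ∀ i j, HasDerivAt (fun z => M z i j) (M' i j) x) :
    HasDerivAt (fun z => (M z).det) (∑ i, ((M x).updateRow i (M' i)).det) x := by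
  let f : ContinuousMultilinearMap ℂ (fun _ : n => n → ℂ) ℂ :=
    { (Matrix.detRowAlternating (n := n) (R := ℂ)).toMultilinearMap with
      cont := Continuous.matrix_det (A := fun M : Matrix n n ℂ => M) continuous_id }
  have hrow : ∀ i, HasFDerivAt (fun z => M z i) ((1 : ℂ →L[ℂ] ℂ).smulRight (M' i)) x := fun i =>
    (hasDerivAt_pi.2 fun j => h i j).hasFDerivAt
  have hf := (HasFDerivAt.multilinear_comp (f := f) hrow).hasDerivAt
  convert! hf using 1
  simp only [sum_apply]
  refine Finset.sum_congr rfl fun i _ => ?_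
  simp
  rfl

/-- A solution of a linear differential system with analytic coefficients that vanishes at a point
vanishes to infinite order there. -/
lemma analyticOrderAt_eq_top_of_linear_system {ι : Type*} [Fintype ι] {u : ι → ℂ → ℂ}
    {A : ι → ι → ℂ → ℂ} {x : ℂ} (hu : ∀ i, AnalyticAt ℂ (u i) x)
    (hA : ∀ i j, AnalyticAt ℂ (A i j) x) (hu0 : ∀ i, u i x = 0)
    (h : ∀ i, ∀ᶠ z in 𝓝 x, deriv (u i) z = ∑ j, A i j z * u j z) (i : ι) :
    analyticOrderAt (u i) x = ⊤ := by
  have key : ∀ n : ℕ, ∀ i, (n : ℕ∞) ≤ analyticOrderAt (u i) x := by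
    intro n
    induction n with
    | zero => simp
    | succ n ih =>
      intro i
      -- If all `u j` are divisible by `(z-x)^n`, the system makes every derivative divisible by it
      -- too; as `u i` vanishes at `x`, its order is one higher.
      choose g hg hgu using fun j => (natCast_le_analyticOrderAt (hu j)).1 (ih j)
      have hd : (n : ℕ∞) ≤ analyticOrderAt (deriv (u i)) x := by
        refine (natCast_le_analyticOrderAt (hu i).deriv).2 ⟨fun z => ∑ j, A i j z * g j z, ?_, ?_⟩
        · exact Finset.analyticAt_fun_sum _ fun j _ => (hA i j).mul (hg j)
        · filter_upwards [h i, eventually_all.2 hgu] with z hz hgz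
          rw [hz, smul_eq_mul, Finset.mul_sum]
          refine Finset.sum_congr rfl fun j _ => ?_
          rw [hgz j, smul_eq_mul]
          ring
      have h1 := (hu i).analyticOrderAt_deriv_add_one
      simp only [hu0 i, sub_zero] at h1
      change _ = analyticOrderAt (u i) x at h1
      rw [← h1]
      push_cast
      gcongr
  exact ENat.eq_top_iff_forall_ge.2 fun n => key n i

/-! ### Serre derivatives -/

section Serre

variable {E : ℍ → ℂ}

lemma differentiableAt_comp_ofComplex {f : ℍ → ℂ} (hf : MDiff f) (z : ℍ) :
    DifferentiableAt ℂ (f ∘ ofComplex) z :=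
  mdifferentiableAt_iff.1 (hf z)

lemma analyticAt_comp_ofComplex {f : ℍ → ℂ} (hf : MDiff f) {z : ℂ} (hz : z ∈ upperHalfPlaneSet) :
    AnalyticAt ℂ (f ∘ ofComplex) z :=
  (UpperHalfPlane.mdifferentiable_iff.1 hf).analyticAt (isOpen_upperHalfPlaneSet.mem_nhds hz)

lemma mdiff_serre (hE : MDiff E) (k : ℤ) {f : ℍ → ℂ} (hf : MDiff f) : MDiff (serre μ E k f) := by
  refine mdiff_of_differentiableAt (F := fun z => thetaFactor μ * deriv (f ∘ ofComplex) z -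
    (k : ℂ) * ((μ : ℂ) - 2) / (4 * μ) * (E ∘ ofComplex) z * (f ∘ ofComplex) z) ?_ ?_
  · intro z hz
    have h1 := (analyticAt_comp_ofComplex hE hz).differentiableAt
    have h2 := analyticAt_comp_ofComplex hf hz
    exact (h2.deriv.differentiableAt.const_mul _).sub
      ((h1.const_mul _).mul h2.differentiableAt)
  · intro z
    simp only [Function.comp_apply, ofComplex_apply]
    rfl

lemma mdiff_serreIter (hE : MDiff E) (k : ℤ) (n : ℕ) {f : ℍ → ℂ} (hf : MDiff f) :
    MDiff (serreIter μ E k n f) := by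
  induction n with
  | zero => exact hf
  | succ n ih => exact mdiff_serre hE _ ih

lemma thetaFactor_mul_deriv_serreIter (k : ℤ) (n : ℕ) (f : ℍ → ℂ) (z : ℍ) :
    thetaFactor μ * deriv (serreIter μ E k n f ∘ ofComplex) z =
      serreIter μ E k (n + 1) f z +
        ((k + 2 * n : ℤ) : ℂ) * ((μ : ℂ) - 2) / (4 * μ) * E z * serreIter μ E k n f z := by
  change _ = (thetaFactor μ * deriv (serreIter μ E k n f ∘ ofComplex) z - _) + _
  ring

variable {w : ℤ} {r : ℕ} {B : ∀ j : ℕ, AutomorphicForm μ (2 * j)}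

/-- The matrix of the first order system equivalent to the differential equation. -/
def systemMatrix (E : ℍ → ℂ) (w : ℤ) (r : ℕ) (B : ∀ j : ℕ, AutomorphicForm μ (2 * j))
    (j k : Fin (r + 1)) (z : ℍ) : ℂ :=
  (if k = j then ((w - r + 2 * j : ℤ) : ℂ) * ((μ : ℂ) - 2) / (4 * μ) * E z else 0) +
    if (j : ℕ) < r then (if (k : ℕ) = j + 1 then 1 else 0)
    else if (k : ℕ) < r then -B (r + 1 - k) z else 0

/-- The last row has no `B` in column `r`, because the equation has no `B₂` term; so only `E` enters
the trace. -/
lemma systemMatrix_self (j : Fin (r + 1)) (z : ℍ) : systemMatrix E w r B j j z =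
    ((w - r + 2 * j : ℤ) : ℂ) * ((μ : ℂ) - 2) / (4 * μ) * E z := by
  unfold systemMatrix
  by_cases h : (j : ℕ) < r <;> simp [h]

lemma mdiff_systemMatrix (hE : MDiff E) (j k : Fin (r + 1)) :
    MDiff (systemMatrix E w r B j k) := by
  have hBd : MDiff (B (r + 1 - k) : ℍ → ℂ) := ModularFormClass.holo (B (r + 1 - k))
  refine mdiff_of_differentiableAt (F := fun z => (if k = j then
    ((w - r + 2 * j : ℤ) : ℂ) * ((μ : ℂ) - 2) / (4 * μ) * (E ∘ ofComplex) z else 0) +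
    if (j : ℕ) < r then (if (k : ℕ) = j + 1 then 1 else 0)
    else if (k : ℕ) < r then -(B (r + 1 - k) ∘ ofComplex) z else 0) ?_ ?_
  · intro z hz
    have h1 := (analyticAt_comp_ofComplex hE hz).differentiableAt
    have h2 := (analyticAt_comp_ofComplex hBd hz).differentiableAt
    refine DifferentiableAt.add ?_ ?_
    · split_ifs
      · exact h1.const_mul _
      · exact differentiableAt_const _
    · split_ifs
      · exact differentiableAt_const _
      · exact differentiableAt_const _
      · exact h2.neg
      · exact differentiableAt_const _
  · intro z
    simp only [Function.comp_apply, ofComplex_apply]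
    rfl

/-- A solution of the differential equation yields a solution of the first order system. -/
lemma deriv_serreIter_eq_sum {y : ℍ → ℂ} {z : ℍ} (hy : odeLHS μ E w r B y z = 0)
    (j : Fin (r + 1)) :
    thetaFactor μ * deriv (serreIter μ E (w - r) j y ∘ ofComplex) z =
      ∑ k : Fin (r + 1), systemMatrix E w r B j k z * serreIter μ E (w - r) k y z := by
  rw [thetaFactor_mul_deriv_serreIter]
  simp only [systemMatrix, add_mul, Finset.sum_add_distrib, ite_mul, zero_mul,
    Finset.sum_ite_eq', Finset.mem_univ, if_true]
  rw [add_comm]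
  congr 1
  by_cases h : (j : ℕ) < r
  · simp only [h, if_true, one_mul]
    rw [Finset.sum_eq_single (⟨j + 1, by omega⟩ : Fin (r + 1))]
    · simp
    · intro b _ hb
      rw [if_neg]
      intro h'
      exact hb (Fin.ext h')
    · simp
  · have hj : (j : ℕ) = r := by omega
    simp only [h, if_false]
    rw [Fin.sum_univ_eq_sum_range (fun k => if k < r then
      -B (r + 1 - k) z * serreIter μ E (w - r) k y z else 0) (r + 1), Finset.sum_range_succ,
      if_neg (lt_irrefl r), add_zero, hj]
    unfold odeLHS at hy
    -- The last row is the equation solved for its top derivative; `k = r + 1 - m` matches `2 ≤ m ≤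
    -- r + 1` with `0 ≤ k < r`.
    rw [eq_neg_of_add_eq_zero_left hy, ← Finset.sum_neg_distrib]
    refine Finset.sum_nbij' (fun m => r + 1 - m) (fun k => r + 1 - k) ?_ ?_ ?_ ?_ ?_
    · intro m hm
      simp only [Finset.mem_Icc, Finset.mem_range] at hm ⊢
      omega
    · intro k hk
      simp only [Finset.mem_Icc, Finset.mem_range] at hk ⊢
      omega
    · intro m hm
      simp only [Finset.mem_Icc] at hm
      omega
    · intro k hk
      simp only [Finset.mem_range] at hk
      omega
    · intro m hm
      simp only [Finset.mem_Icc] at hm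
      have h1 : r + 1 - m < r := by omega
      have h2 : r + 1 - (r + 1 - m) = m := by omega
      -- The type of `B n` depends on `n`, so the index is changed at the level of values.
      have h3 : ∀ n, n = m → B n z = B m z := by
        rintro n rfl
        rfl
      simp only [h1, if_true, neg_mul, h3 _ h2]

end Serre

section Wronskian

variable {E : ℍ → ℂ} {w : ℤ} {r : ℕ} {B : ∀ j : ℕ, AutomorphicForm μ (2 * j)}
  {Y : Fin (r + 1) → ℍ → ℂ}

/-! ### The Wronskian -/

lemma sum_weights (w : ℤ) (r : ℕ) :
    ∑ j : Fin (r + 1), ((w - r + 2 * j : ℤ) : ℂ) = (w : ℂ) * (r + 1) := by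
  have h := Fin.sum_univ_eq_sum_range (fun j => ((w - r + 2 * j : ℤ) : ℂ)) (r + 1)
  rw [h]
  have key : ∀ n : ℕ, ∑ j ∈ Finset.range (n + 1), ((w - r + 2 * j : ℤ) : ℂ) =
      (n + 1) * (w - r + n) := by
    intro n
    induction n with
    | zero => simp
    | succ n ih =>
      rw [Finset.sum_range_succ, ih]
      push_cast
      ring
  rw [key]
  ring

/-- Abel's identity for the Wronskian. -/
lemma IsFundamentalSolution.hasDerivAt_wronskian (hμ : 3 ≤ μ) (hE : MDiff E)
    (hY : IsFundamentalSolution μ E w r B Y) (z : ℍ) :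
    HasDerivAt (wronskian μ E w r Y ∘ ofComplex)
      ((thetaFactor μ)⁻¹ * ((w : ℂ) * (r + 1) * (((μ : ℂ) - 2) / (4 * μ)) * E z *
        wronskian μ E w r Y z)) z := by
  have hκ := thetaFactor_ne_zero hμ
  -- Transposed so that rows are indexed by the order of derivation: the system then reads `M' = A
  -- M`.
  let M : ℂ → Matrix (Fin (r + 1)) (Fin (r + 1)) ℂ := fun x =>
    Matrix.of fun j i => (serreIter μ E (w - r) j (Y i) ∘ ofComplex) x
  have hW : ∀ x, (wronskian μ E w r Y ∘ ofComplex) x = (M x).det := fun x =>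
    (Matrix.det_transpose _).symm
  have hWz : wronskian μ E w r Y z = (M z).det := by
    rw [← hW, Function.comp_apply, ofComplex_apply]
  let A : Matrix (Fin (r + 1)) (Fin (r + 1)) ℂ := Matrix.of fun j k =>
    (thetaFactor μ)⁻¹ * systemMatrix E w r B j k z
  have hd : ∀ j i, HasDerivAt (fun x => M x j i) ((∑ k, A j k • M z k) i) z := by
    intro j i
    have h1 := (differentiableAt_comp_ofComplex
      (mdiff_serreIter (μ := μ) hE (w - r) j (hY.holo i)) z).hasDerivAt
    convert! h1 using 1
    apply mul_left_cancel₀ hκ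
    rw [deriv_serreIter_eq_sum (hY.solves i z) j, Finset.sum_apply, Finset.mul_sum]
    refine Finset.sum_congr rfl fun k _ => ?_
    simp only [A, M, Matrix.of_apply, Pi.smul_apply, smul_eq_mul, Function.comp_apply,
      ofComplex_apply]
    field_simp
  have hdet := hasDerivAt_det (M' := fun j i => (∑ k, A j k • M z k) i) hd
  rw [funext hW, hWz]
  convert! hdet using 1
  -- Replacing row `j` by a combination of all rows multiplies the determinant by the coefficient `A
  -- j j`.
  have hsum : ∀ j, ((M z).updateRow j fun i => (∑ k, A j k • M z k) i).det =
      (thetaFactor μ)⁻¹ * (((w - r + 2 * j : ℤ) : ℂ) * ((((μ : ℂ) - 2) / (4 * μ)) * E z *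
        (M z).det)) := by
    intro j
    have h := Matrix.det_updateRow_sum (M z) j (A j)
    refine h.trans ?_
    simp only [A, Matrix.of_apply, systemMatrix_self, smul_eq_mul]
    ring
  rw [Finset.sum_congr rfl fun j _ => hsum j, ← Finset.mul_sum, ← Finset.sum_mul, sum_weights]
  ring

/-- The Wronskian of a fundamental system vanishes nowhere. -/
lemma IsFundamentalSolution.wronskian_ne_zero (hμ : 3 ≤ μ) (hE : MDiff E)
    (hY : IsFundamentalSolution μ E w r B Y) (z : ℍ) : wronskian μ E w r Y z ≠ 0 := by
  intro h0
  have hκ := thetaFactor_ne_zero hμ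
  -- A kernel vector gives a solution `∑ cᵢ Yᵢ` whose Serre derivatives up to order `r` all vanish
  -- at `z`; uniqueness and the identity theorem make it zero on `ℍ`, against independence.
  obtain ⟨c, hc, hc0⟩ := Matrix.exists_vecMul_eq_zero_iff.2 h0
  let u : Fin (r + 1) → ℂ → ℂ := fun j x =>
    ∑ i, c i * (serreIter μ E (w - r) j (Y i) ∘ ofComplex) x
  have han : ∀ i j : Fin (r + 1), ∀ x ∈ upperHalfPlaneSet,
      AnalyticAt ℂ (serreIter μ E (w - r) j (Y i) ∘ ofComplex) x := fun i j x hx =>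
    analyticAt_comp_ofComplex (mdiff_serreIter hE _ _ (hY.holo i)) hx
  have hu : ∀ j, ∀ x ∈ upperHalfPlaneSet, AnalyticAt ℂ (u j) x := fun j x hx =>
    Finset.analyticAt_fun_sum _ fun i _ => analyticAt_const.mul (han i j x hx)
  have htop := analyticOrderAt_eq_top_of_linear_system (u := u) (x := z)
    (A := fun j k x => (thetaFactor μ)⁻¹ * (systemMatrix E w r B j k ∘ ofComplex) x)
    (fun j => hu j z z.2)
    (fun j k => analyticAt_const.mul (analyticAt_comp_ofComplex (mdiff_systemMatrix hE j k) z.2))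
    (fun j => by
      have := congrFun hc0 j
      simpa [u, Matrix.vecMul, dotProduct] using this)
    (fun j => by
      filter_upwards [isOpen_upperHalfPlaneSet.mem_nhds z.2] with x hx
      apply mul_left_cancel₀ hκ
      have hd : deriv (u j) x =
          ∑ i, c i * deriv (serreIter μ E (w - r) j (Y i) ∘ ofComplex) x := by
        change deriv (fun x => ∑ i, c i * (serreIter μ E (w - r) j (Y i) ∘ ofComplex) x) x = _
        rw [deriv_fun_sum fun i _ => (han i j x hx).differentiableAt.const_mul (c i)]
        exact Finset.sum_congr rfl fun i _ => deriv_const_mul_field _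
      lift x to ℍ using hx
      rw [hd, Finset.mul_sum, Finset.mul_sum]
      simp only [u, Function.comp_apply, ofComplex_apply, Finset.mul_sum]
      rw [Finset.sum_comm]
      refine Finset.sum_congr rfl fun i _ => ?_
      rw [mul_left_comm, deriv_serreIter_eq_sum (hY.solves i x) j, Finset.mul_sum]
      refine Finset.sum_congr rfl fun k _ => ?_
      field_simp) 0
  have hzero : Set.EqOn (u 0) 0 upperHalfPlaneSet :=
    AnalyticOnNhd.eqOn_zero_of_preconnected_of_eventuallyEq_zero (fun x hx => hu 0 x hx)
      isConnected_upperHalfPlaneSet.isPreconnected z.2 (analyticOrderAt_eq_top.1 htop)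
  apply hc
  funext i
  refine Fintype.linearIndependent_iff.1 hY.indep c ?_ i
  funext x
  have hx := hzero x.2
  simpa [u, serreIter] using hx

end Wronskian

/-! ### Comparison of the Wronskian with the discriminant -/

lemma IsHeckeHalphen.mdiff_E2 (hμ : 3 ≤ μ) (hy : IsHeckeHalphen μ y₁ y₂ y₃) :
    MDiff (E2 μ y₁ y₂ y₃) := by
  obtain ⟨N, e, hN, he, -, -⟩ := exists_discriminant_eq μ
  refine mdiff_of_differentiableAt (F := fun z => thetaFactor μ / (2 * N * μ * constB μ) *
    logDeriv (toMeromorphicNFOn (rawDiscriminant μ N e (hauptmodul y₁ y₂ y₃))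
      upperHalfPlaneSet) z) (fun z hz => ?_) (hy.E2_eq hμ hN he)
  have hD := hy.analyticOnNhd_discriminant hμ hN he z hz
  exact ((hD.deriv.div hD (hy.discriminant_ne_zero hμ hN he hz)).differentiableAt).const_mul _

/-- `θ L = δ b E₂` for every branch `L` of the logarithm of the discriminant. -/
lemma IsHeckeHalphen.E2_eq_deriv_logBranch (hμ : 3 ≤ μ) (hy : IsHeckeHalphen μ y₁ y₂ y₃)
    {L : ℍ → ℂ} (hL : IsLogBranch L (discriminant μ (hauptmodul y₁ y₂ y₃))) (z : ℍ) :
    E2 μ y₁ y₂ y₃ z = thetaFactor μ / (delta μ * constB μ) * deriv (L ∘ ofComplex) z := by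
  obtain ⟨N, e, hN, he, hδ, hdisc⟩ := exists_discriminant_eq μ
  rw [hy.E2_eq hμ hN he, hδ]
  set D := toMeromorphicNFOn (rawDiscriminant μ N e (hauptmodul y₁ y₂ y₃)) upperHalfPlaneSet
  have hev : D =ᶠ[𝓝 (z : ℂ)] fun x => exp ((L ∘ ofComplex) x) := by
    filter_upwards [isOpen_upperHalfPlaneSet.mem_nhds z.2] with x hx
    lift x to ℍ using hx
    rw [Function.comp_apply, ofComplex_apply, hL.2, hdisc]
  have hd := (differentiableAt_comp_ofComplex hL.1 z).hasDerivAt.cexp.deriv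
  have hlog : logDeriv D z = deriv (L ∘ ofComplex) z := by
    rw [logDeriv_apply, hev.deriv_eq, hev.eq_of_nhds, hd, mul_div_cancel_left₀ _ (exp_ne_zero _)]
  rw [hlog]
  push_cast
  ring

end Hecke

end

theorem mainTheorem2
    (μ : ℕ) (hμ : 3 ≤ μ)
    (y₁ y₂ y₃ : ℂ → ℂ) (hy : Hecke.IsHeckeHalphen μ y₁ y₂ y₃)
    (w : ℤ) (r : ℕ) (B : ∀ j : ℕ, Hecke.AutomorphicForm μ (2 * j))
    (Λ : Fin (r + 1) → ℤ) (hΛ : Antitone Λ) (hΛ_nonneg : ∀ i, 0 ≤ Λ i)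
    (hΛ_roots : (Hecke.indicial μ (Hecke.E2 μ y₁ y₂ y₃) w r B).roots =
      Finset.univ.val.map fun i => (Λ i : ℂ))
    (Y : Fin (r + 1) → ℍ → ℂ)
    (hY : Hecke.IsFundamentalSolution μ (Hecke.E2 μ y₁ y₂ y₃) w r B Y) :
    (∃ L : ℍ → ℂ,
      Hecke.IsLogBranch L (Hecke.discriminant μ (Hecke.hauptmodul y₁ y₂ y₃))) ∧
    ∀ L : ℍ → ℂ,
      Hecke.IsLogBranch L (Hecke.discriminant μ (Hecke.hauptmodul y₁ y₂ y₃)) →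
      ∃ C : ℂ, C ≠ 0 ∧ ∀ z : ℍ,
        Hecke.wronskian μ (Hecke.E2 μ y₁ y₂ y₃) w r Y z =
          C * Complex.exp ((w : ℂ) * (r + 1) / Hecke.delta μ * L z) := by
  obtain ⟨N, e, hN, he, hδ, hdisc⟩ := Hecke.exists_discriminant_eq μ
  refine ⟨Hecke.exists_isLogBranch (hy.analyticOnNhd_discriminant hμ hN he)
    (fun z hz => hy.discriminant_ne_zero hμ hN he hz) (hdisc _), fun L hL => ?_⟩
  have hE := hy.mdiff_E2 hμ
  set W := Hecke.wronskian μ (Hecke.E2 μ y₁ y₂ y₃) w r Y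
  set p : ℂ := (w : ℂ) * (r + 1) / Hecke.delta μ with hp
  have hκ := Hecke.thetaFactor_ne_zero hμ
  have hb := Hecke.constB_ne_zero hμ
  have hδ0 : (Hecke.delta μ : ℂ) ≠ 0 := by
    rw [hδ]
    exact_mod_cast (by positivity : 2 * (N * μ) ≠ 0)
  -- `W` and `exp (p L)` have the same logarithmic derivative: `θW = w(r+1) b E₂ W`, while `p θL = p
  -- δ b E₂ = w(r+1) b E₂`.
  have hder : ∀ z : ℍ, HasDerivAt (fun x => (W ∘ ofComplex) x *
      Complex.exp (-(p * (L ∘ ofComplex) x))) 0 z := by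
    intro z
    have h1 := hY.hasDerivAt_wronskian hμ hE z
    have h2 := ((Hecke.differentiableAt_comp_ofComplex hL.1 z).hasDerivAt.const_mul p).neg.cexp
    convert! h1.mul h2 using 1
    rw [hy.E2_eq_deriv_logBranch hμ hL z, ← Hecke.constB_eq hμ, hp]
    simp only [Function.comp_apply, ofComplex_apply]
    field_simp
    ring
  obtain ⟨C, hC⟩ := isOpen_upperHalfPlaneSet.exists_is_const_of_deriv_eq_zero
    Hecke.isConnected_upperHalfPlaneSet.isPreconnected
    (fun x hx => (hder ⟨x, hx⟩).differentiableAt.differentiableWithinAt)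
    (fun x hx => (hder ⟨x, hx⟩).deriv)
  have hWC : ∀ z : ℍ, W z = C * Complex.exp (p * L z) := by
    intro z
    have h := hC z z.2
    simp only [Function.comp_apply, ofComplex_apply] at h
    rw [← h, mul_assoc, ← Complex.exp_add, neg_add_cancel, Complex.exp_zero, mul_one]
  refine ⟨C, ?_, hWC⟩
  rintro rfl
  exact hY.wronskian_ne_zero hμ hE UpperHalfPlane.I (by rw [show Hecke.wronskian μ _ w r Y _ = _
    from hWC UpperHalfPlane.I, zero_mul])
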